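/- Let $d$ be a non-negative integer and let $X_d$ be the associative unital real algebra generated by $e_1,\dots,e_{d+2}$ subject to the relations $e_je_k=-e_ke_j$ for distinct $j,k\le d+1$, $e_j^2=-1$ for $j\le d+1$, $e_{d+2}^2=0$, and $e_{d+2}e_j=e_je_{d+2}$ for $j\le d+1$. For $v\in\mathbb R^d$ put $i(v)=v_1e_1+\dots+v_de_d$. Let $\alpha$ be the automorphism of $X_d$ with $\alpha(e_j)=-e_j$ for $j\le d+1$ and $\alpha(e_{d+2})=e_{d+2}$, let $t$ be the anti-automorphism of $X_d$ that fixes every $e_j$, and put $\overline x=\alpha(t(x))$ and $N(x)=x\overline x$. Let $Z_d^0\subset X_d$ be the linear subspace with basis the products (in increasing order) of an even number of distinct elements of $\{e_1,\dots,e_d,e_{d+1}e_{d+2}\}$, the empty product being $\mathbf 1$, and let $H_0\subset Z_d^0$ be the hyperplane of elements whose coordinate at $\mathbf 1$ is zero in this basis. Define $$\mathrm{Spun}(d)=\{z\in Z_d^0:\ N(z)=\mathbf 1\text{ and for every }v\in\mathbb R^d\text{ there is }w\in\mathbb R^d\text{ with }z(e_{d+2}i(v)+e_{d+1})\overline z=e_{d+2}i(w)+e_{d+1}\},$$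 and for $a,p\in\mathbb R^d$ let $$T_{ap}=\{x\in \mathrm{Spun}(d):\ x(e_{d+2}i(a)+e_{d+1})\overline x=e_{d+2}i(p)+e_{d+1}\},$$ the set of elements of $\mathrm{Spun}(d)$ whose action on $\mathbb R^d$ takes $a$ to $p$. Let $\mathcal P$ be a finite set of points in $\mathbb R^d$, and write $|ab|$ for the Euclidean distance. Let $Q$ be the set of quadruples $(a,p,b,q)\in\mathcal P^4$ with $|ab|=|pq|>0$, and let $Q'$ be the set of quadruples $(a,p,b,q)\in\mathcal P^4$ with $a\ne b$ such that $T_{ap}\cap T_{bq}\not\subseteq H_0$. Then $Q'\subseteq Q$ and $|Q'|\ge |Q|/2$. -/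

import Mathlib

/- The definitions below set up the following objects.
The algebra `X_d`, the group `Spun(d)`, the sets `T_{ap}`, and the sets of quadruples `Q`, `Q'`.
The generators `e_1, …, e_{d+2}` are indexed by `Fin (d + 2)`, starting from `0`.
-/

namespace SpunGroup

/-- The defining relations of `X_d`, on the free algebra on `e_1, …, e_{d+2}` (that is, the tensor
algebra of `ℝ^{d+2}`): the first `d + 1` generators anticommute pairwise and square to `-1`,
while `e_{d+2}` squares to `0` and commutes with the other generators. -/
inductive Rel (d : ℕ) : FreeAlgebra ℝ (Fin (d + 2)) → FreeAlgebra ℝ (Fin (d + 2)) → Prop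
  | anticomm (j k : Fin (d + 1)) (hjk : j ≠ k) :
      Rel d (FreeAlgebra.ι ℝ j.castSucc * FreeAlgebra.ι ℝ k.castSucc
        + FreeAlgebra.ι ℝ k.castSucc * FreeAlgebra.ι ℝ j.castSucc) 0
  | sq (j : Fin (d + 1)) :
      Rel d (FreeAlgebra.ι ℝ j.castSucc * FreeAlgebra.ι ℝ j.castSucc + 1) 0
  | sq_last :
      Rel d (FreeAlgebra.ι ℝ (Fin.last (d + 1)) * FreeAlgebra.ι ℝ (Fin.last (d + 1))) 0
  | comm_last (j : Fin (d + 1)) :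
      Rel d (FreeAlgebra.ι ℝ (Fin.last (d + 1)) * FreeAlgebra.ι ℝ j.castSucc
        - FreeAlgebra.ι ℝ j.castSucc * FreeAlgebra.ι ℝ (Fin.last (d + 1))) 0

/-- The real algebra `X_d`. -/
def X (d : ℕ) : Type := RingQuot (Rel d)

noncomputable instance (d : ℕ) : Ring (X d) := inferInstanceAs (Ring (RingQuot (Rel d)))

noncomputable instance (d : ℕ) : Algebra ℝ (X d) := inferInstanceAs (Algebra ℝ (RingQuot (Rel d)))

/-- The quotient map from the free algebra to `X_d`. -/
noncomputable def mk (d : ℕ) : FreeAlgebra ℝ (Fin (d + 2)) →ₐ[ℝ] X d :=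
  RingQuot.mkAlgHom ℝ (Rel d)

theorem mk_rel {d : ℕ} {x y : FreeAlgebra ℝ (Fin (d + 2))} (h : Rel d x y) : mk d x = mk d y :=
  RingQuot.mkAlgHom_rel ℝ h

/-- The universal property of the quotient `X_d`. -/
noncomputable def lift (d : ℕ) {A : Type} [Ring A] [Algebra ℝ A] (g : Fin (d + 2) → A)
    (hg : ∀ x y, Rel d x y → FreeAlgebra.lift ℝ g x = FreeAlgebra.lift ℝ g y) : X d →ₐ[ℝ] A :=
  RingQuot.liftAlgHom ℝ ⟨FreeAlgebra.lift ℝ g, fun {x y} h => hg x y h⟩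

/-- The generators `e_1, …, e_{d+2}` of `X_d`. -/
noncomputable def e (d : ℕ) (j : Fin (d + 2)) : X d :=
  mk d (FreeAlgebra.ι ℝ j)

theorem lift_e (d : ℕ) {A : Type} [Ring A] [Algebra ℝ A] (g : Fin (d + 2) → A)
    (hg : ∀ x y, Rel d x y → FreeAlgebra.lift ℝ g x = FreeAlgebra.lift ℝ g y)
    (j : Fin (d + 2)) : lift d g hg (e d j) = g j := by
  have h := RingQuot.liftAlgHom_mkAlgHom_apply ℝ (FreeAlgebra.lift ℝ g)
    (fun {x y} h => hg x y h) (FreeAlgebra.ι ℝ j)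
  rw [FreeAlgebra.lift_ι_apply] at h
  exact h

theorem e_anticomm (d : ℕ) (j k : Fin (d + 1)) (hjk : j ≠ k) :
    e d j.castSucc * e d k.castSucc + e d k.castSucc * e d j.castSucc = 0 := by
  simpa [e] using mk_rel (Rel.anticomm j k hjk)

theorem e_sq (d : ℕ) (j : Fin (d + 1)) : e d j.castSucc * e d j.castSucc + 1 = 0 := by
  simpa [e] using mk_rel (Rel.sq j)

theorem e_sq_last (d : ℕ) : e d (Fin.last (d + 1)) * e d (Fin.last (d + 1)) = 0 := by
  simpa [e] using mk_rel (Rel.sq_last (d := d))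

theorem e_comm_last (d : ℕ) (j : Fin (d + 1)) :
    e d (Fin.last (d + 1)) * e d j.castSucc - e d j.castSucc * e d (Fin.last (d + 1)) = 0 := by
  simpa [e] using mk_rel (Rel.comm_last j)

/-- The automorphism `α` of `X_d` with `α(e_j) = -e_j` for `j ≤ d + 1` and
`α(e_{d+2}) = e_{d+2}`. -/
noncomputable def alpha (d : ℕ) : X d →ₐ[ℝ] X d :=
  lift d (Fin.lastCases (e d (Fin.last (d + 1)))
    (fun j : Fin (d + 1) => -e d j.castSucc)) (by
      intro x y h
      cases h with
      | anticomm j k hjk => simpa using e_anticomm d j k hjk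
      | sq j => simpa using e_sq d j
      | sq_last => simpa using e_sq_last d
      | comm_last j =>
        have h := e_comm_last d j
        rw [sub_eq_zero] at h
        simp [h])

/-- The anti-automorphism `t` of `X_d` with `t(e_j) = e_j` for every `j`, as a homomorphism to the
opposite algebra. -/
noncomputable def transposeOp (d : ℕ) : X d →ₐ[ℝ] (X d)ᵐᵒᵖ :=
  lift d (fun j => MulOpposite.op (e d j)) (by
      intro x y h
      apply MulOpposite.unop_injective
      cases h with
      | anticomm j k hjk => simpa [add_comm] using e_anticomm d j k hjk
      | sq j => simpa using e_sq d j
      | sq_last => simpa using e_sq_last d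
      | comm_last j =>
        have h := e_comm_last d j
        rw [sub_eq_zero] at h
        simp [h])

/-- The conjugate `x̄ = α(t(x))`. -/
noncomputable def conj (d : ℕ) (x : X d) : X d := alpha d (MulOpposite.unop (transposeOp d x))

/-- The norm `N(x) = x x̄`. -/
noncomputable def N (d : ℕ) (x : X d) : X d := x * conj d x

/-- The linear map `i : ℝ^d → X_d` sending the standard basis to `e_1, …, e_d`. -/
noncomputable def i (d : ℕ) (v : EuclideanSpace ℝ (Fin d)) : X d :=
  ∑ j : Fin d, v j • e d j.castSucc.castSucc

/-- The `d + 1` elements `e_1, …, e_d, e_{d+1}e_{d+2}`. -/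
noncomputable def f (d : ℕ) : Fin (d + 1) → X d :=
  Fin.lastCases (e d (Fin.last d).castSucc * e d (Fin.last (d + 1)))
    (fun j : Fin d => e d j.castSucc.castSucc)

/-- The product, in increasing order, of the elements of `{e_1, …, e_d, e_{d+1}e_{d+2}}` indexed
by `S`. For `S = ∅` this is `1`. -/
noncomputable def basisElt (d : ℕ) (S : Finset (Fin (d + 1))) : X d :=
  ((S.sort (· ≤ ·)).map (f d)).prod

/-- The subspace `Z_d^0`, with standard basis the products of an even number of elements of
`{e_1, …, e_d, e_{d+1}e_{d+2}}`. -/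
noncomputable def Z0 (d : ℕ) : Submodule ℝ (X d) :=
  Submodule.span ℝ {x | ∃ S : Finset (Fin (d + 1)), Even S.card ∧ x = basisElt d S}

/-- The hyperplane `H_0` of `Z_d^0` of the elements whose coordinate at the basis element `1` is
zero, that is, the span of all the other standard basis elements of `Z_d^0`. -/
noncomputable def H0 (d : ℕ) : Submodule ℝ (X d) :=
  Submodule.span ℝ {x | ∃ S : Finset (Fin (d + 1)), Even S.card ∧ S.Nonempty ∧ x = basisElt d S}

/-- The element `e_{d+2} i(v) + e_{d+1}`, representing the point `v` of `ℝ^d`. -/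
noncomputable def pt (d : ℕ) (v : EuclideanSpace ℝ (Fin d)) : X d :=
  e d (Fin.last (d + 1)) * i d v + e d (Fin.last d).castSucc

/-- The group `Spun(d)`, as a subset of `X_d`. -/
def Spun (d : ℕ) : Set (X d) :=
  {z | z ∈ Z0 d ∧ N d z = 1 ∧
    ∀ v : EuclideanSpace ℝ (Fin d), ∃ w : EuclideanSpace ℝ (Fin d),
      z * pt d v * conj d z = pt d w}

/-- `T_{ap}`: the elements `x` of `Spun(d)` whose action on `ℝ^d` takes `a` to `p`. The action
takes `v` to the point `w` with `x (e_{d+2} i(v) + e_{d+1}) x̄ = e_{d+2} i(w) + e_{d+1}`. -/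
def T (d : ℕ) (a p : EuclideanSpace ℝ (Fin d)) : Set (X d) :=
  {x | x ∈ Spun d ∧ x * pt d a * conj d x = pt d p}

/-- Quadruples of points of `ℝ^d`. -/
abbrev Quad (d : ℕ) : Type :=
  EuclideanSpace ℝ (Fin d) × EuclideanSpace ℝ (Fin d) ×
    EuclideanSpace ℝ (Fin d) × EuclideanSpace ℝ (Fin d)

/-- The set `Q` of quadruples `(a, p, b, q)` of points of `P` with `|ab| = |pq| > 0`. -/
def Q (d : ℕ) (P : Finset (EuclideanSpace ℝ (Fin d))) : Set (Quad d) :=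
  {(a, p, b, q) : Quad d | a ∈ P ∧ p ∈ P ∧ b ∈ P ∧ q ∈ P ∧ dist a b = dist p q ∧ 0 < dist p q}

/-- The set `Q'` of quadruples `(a, p, b, q)` of points of `P` with `a ≠ b` such that
`T_{ap} ∩ T_{bq}` is not contained in `H_0`. -/
def Q' (d : ℕ) (P : Finset (EuclideanSpace ℝ (Fin d))) : Set (Quad d) :=
  {(a, p, b, q) : Quad d | a ∈ P ∧ p ∈ P ∧ b ∈ P ∧ q ∈ P ∧ a ≠ b ∧
    ¬ (T d a p ∩ T d b q ⊆ (H0 d : Set (X d)))}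

end SpunGroup

namespace SpunGroup

variable {d : ℕ}

/-! Put `u = a - b` and `w = p - q`. An `x` in `T_{ap} ∩ T_{bq}` carries `e_{d+2} i(u)` to `e_{d+2}
i(w)`. Once the central factor `e_{d+2}` is cancelled in a representation, squaring gives `‖u‖ =
‖w‖`, hence `Q' ⊆ Q` (`dist_eq_of_act`).

Conversely let `‖u‖ = ‖w‖ > 0`. If `u + w ≠ 0`, the normalised product `i(u + w) i(u)`, two
successive reflections, takes `u` to `w`. Following it by a translation gives an element of `T_{ap}
∩ T_{bq}` whose scalar part is a nonzero multiple of `⟨u + w, u⟩ = ‖u + w‖² / 2`, so it lies outside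
`H_0` (`mem_Q'_of_ne`). If `u + w = 0`, exchanging `p` and `q` replaces `w` by `-w`, and `u - w = 2u
≠ 0`. So every quadruple of `Q`, or its swap, lies in `Q'`, and `|Q| ≤ 2|Q'|`.

The scalar part is read off as a matrix trace that vanishes on `H_0`, so linear independence of the
products spanning `Z_d^0` is never needed. -/

theorem e_last_mul_self : e d (Fin.last (d + 1)) * e d (Fin.last (d + 1)) = 0 := e_sq_last d

theorem e_mul_self (j : Fin (d + 1)) : e d j.castSucc * e d j.castSucc = -1 :=
  eq_neg_of_add_eq_zero_left (e_sq d j)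

theorem e_mul_e {j k : Fin (d + 1)} (h : j ≠ k) :
    e d j.castSucc * e d k.castSucc = -(e d k.castSucc * e d j.castSucc) :=
  eq_neg_of_add_eq_zero_left (e_anticomm d j k h)

theorem e_last_commute_e (j : Fin (d + 1)) :
    Commute (e d (Fin.last (d + 1))) (e d j.castSucc) :=
  sub_eq_zero.mp (e_comm_last d j)

/-! ### Conjugation -/

theorem conj_mul (x y : X d) : conj d (x * y) = conj d y * conj d x := by simp [conj]

theorem conj_add (x y : X d) : conj d (x + y) = conj d x + conj d y := by simp [conj]

theorem conj_smul (c : ℝ) (x : X d) : conj d (c • x) = c • conj d x := by simp [conj]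

theorem conj_one : conj d (1 : X d) = 1 := by simp [conj]

theorem conj_sum {ι : Type*} (s : Finset ι) (g : ι → X d) :
    conj d (∑ j ∈ s, g j) = ∑ j ∈ s, conj d (g j) := by
  simp [conj]

theorem conj_e (j : Fin (d + 1)) : conj d (e d j.castSucc) = -e d j.castSucc := by
  simp [conj, transposeOp, alpha, lift_e]

theorem conj_e_last : conj d (e d (Fin.last (d + 1))) = e d (Fin.last (d + 1)) := by
  simp [conj, transposeOp, alpha, lift_e]

/-! ### The vectors `i v` -/

theorem i_add (v w : EuclideanSpace ℝ (Fin d)) : i d (v + w) = i d v + i d w := by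
  simp [i, add_smul, Finset.sum_add_distrib]

theorem i_smul (c : ℝ) (v : EuclideanSpace ℝ (Fin d)) : i d (c • v) = c • i d v := by
  simp [i, mul_smul, Finset.smul_sum]

theorem i_sub (v w : EuclideanSpace ℝ (Fin d)) : i d (v - w) = i d v - i d w := by
  simp [i, sub_smul, Finset.sum_sub_distrib]

theorem conj_i (v : EuclideanSpace ℝ (Fin d)) : conj d (i d v) = -i d v := by
  simp [i, conj_sum, conj_smul, conj_e]

theorem e_last_commute_i (v : EuclideanSpace ℝ (Fin d)) :
    Commute (e d (Fin.last (d + 1))) (i d v) :=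
  Commute.sum_right _ _ _ fun j _ => (e_last_commute_e j.castSucc).smul_right _

theorem e_mul_i (v : EuclideanSpace ℝ (Fin d)) :
    e d (Fin.last d).castSucc * i d v = -(i d v * e d (Fin.last d).castSucc) := by
  simp only [i, Finset.mul_sum, Finset.sum_mul, ← Finset.sum_neg_distrib, mul_smul_comm,
    smul_mul_assoc]
  refine Finset.sum_congr rfl fun j _ => ?_
  rw [e_mul_e (Fin.castSucc_lt_last j).ne', smul_neg]

theorem i_mul_i_add_swap (v w : EuclideanSpace ℝ (Fin d)) :
    i d v * i d w + i d w * i d v = (-2 * inner ℝ v w) • (1 : X d) := by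
  have h (j k : Fin d) : e d j.castSucc.castSucc * e d k.castSucc.castSucc +
      e d k.castSucc.castSucc * e d j.castSucc.castSucc =
        if j = k then (-2 : ℝ) • (1 : X d) else 0 := by
    split_ifs with hjk
    · subst hjk
      rw [e_mul_self]
      norm_num [neg_smul, two_smul]
    · exact e_anticomm d _ _ (by simpa using hjk)
  have hwv : i d w * i d v =
      ∑ j, ∑ k, (v j * w k) • (e d k.castSucc.castSucc * e d j.castSucc.castSucc) := by
    simp only [i, Finset.mul_sum, Finset.sum_mul, mul_smul_comm, smul_mul_assoc, Finset.smul_sum,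
      smul_smul]
  have hvw : i d v * i d w =
      ∑ j, ∑ k, (v j * w k) • (e d j.castSucc.castSucc * e d k.castSucc.castSucc) := by
    rw [Finset.sum_comm]
    simp only [i, Finset.mul_sum, Finset.sum_mul, mul_smul_comm, smul_mul_assoc, Finset.smul_sum,
      smul_smul, mul_comm (v _)]
  rw [hwv, hvw, ← Finset.sum_add_distrib]
  simp only [← Finset.sum_add_distrib, ← smul_add, h, smul_ite, smul_zero, Finset.sum_ite_eq,
    Finset.mem_univ, if_true, smul_smul, ← Finset.sum_smul, PiLp.inner_apply, Finset.mul_sum]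
  congr 1
  refine Finset.sum_congr rfl fun j _ => ?_
  simp
  ring

theorem i_mul_self (v : EuclideanSpace ℝ (Fin d)) :
    i d v * i d v = (-‖v‖ ^ 2) • (1 : X d) := by
  have h := i_mul_i_add_swap v v
  rw [real_inner_self_eq_norm_sq, ← two_smul ℝ, neg_mul, ← mul_neg, mul_smul] at h
  exact smul_right_injective (X d) (two_ne_zero (α := ℝ)) h

/-- Sandwiching by the vector `m` is a scaled reflection. -/
theorem i_mul_i_mul_i (m v : EuclideanSpace ℝ (Fin d)) :
    i d m * i d v * i d m = i d ((‖m‖ ^ 2) • v - (2 * inner ℝ m v) • m) := by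
  have h := eq_sub_of_add_eq (i_mul_i_add_swap m v)
  rw [h, sub_mul, mul_assoc, i_mul_self, i_sub, i_smul, i_smul]
  simp only [smul_mul_assoc, mul_smul_comm, one_mul, mul_one]
  module

/-! ### The even subspace -/

theorem f_castSucc (j : Fin d) : f d j.castSucc = e d j.castSucc.castSucc := by simp [f]

theorem f_last : f d (Fin.last d) = e d (Fin.last d).castSucc * e d (Fin.last (d + 1)) := by
  simp [f]

theorem f_mul_f {j k : Fin (d + 1)} (h : j ≠ k) : f d j * f d k = -(f d k * f d j) := by
  have key (j : Fin d) : f d (Fin.last d) * f d j.castSucc =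
      -(f d j.castSucc * f d (Fin.last d)) := by
    rw [f_castSucc, f_last, mul_assoc, (e_last_commute_e _).eq, ← mul_assoc,
      e_mul_e (Fin.castSucc_lt_last j).ne', neg_mul, mul_assoc]
  induction j using Fin.lastCases with
  | last =>
    induction k using Fin.lastCases with
    | last => exact absurd rfl h
    | cast k => exact key k
  | cast j =>
    induction k using Fin.lastCases with
    | last => rw [key, neg_neg]
    | cast k => simpa only [f_castSucc] using e_mul_e h

/-- The scalar is `-1` for a vector and `0` for `e_{d+1}e_{d+2}`; membership in a span never needs
its value. -/
theorem f_mul_self (j : Fin (d + 1)) : ∃ c : ℝ, f d j * f d j = c • (1 : X d) := by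
  induction j using Fin.lastCases with
  | last =>
    refine ⟨0, ?_⟩
    rw [f_last, mul_assoc, ← mul_assoc (e d (Fin.last (d + 1))), (e_last_commute_e _).eq,
      mul_assoc, e_last_mul_self]
    simp
  | cast j => exact ⟨-1, by rw [f_castSucc, e_mul_self]; simp⟩

theorem basisElt_empty : basisElt d ∅ = 1 := by simp [basisElt]

theorem basisElt_insert {a : Fin (d + 1)} {S : Finset (Fin (d + 1))} (h : ∀ x ∈ S, a < x) :
    basisElt d (insert a S) = f d a * basisElt d S := by
  rw [basisElt, Finset.sort_insert _ (fun b hb => (h b hb).le) (fun ha => lt_irrefl _ (h a ha))]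
  simp [basisElt]

/-- The new factor anticommutes past the smaller ones until it either finds its place or meets its
own copy, where the square is a scalar. -/
theorem f_mul_basisElt (S : Finset (Fin (d + 1))) (j : Fin (d + 1)) :
    ∃ c : ℝ, f d j * basisElt d S = c • basisElt d (symmDiff S {j}) := by
  induction S using Finset.induction_on_min with
  | empty => exact ⟨1, by rw [← Finset.bot_eq_empty, bot_symmDiff, one_smul, ← insert_empty_eq,
      basisElt_insert (by simp)]; rfl⟩
  | insert a S ha ih =>
    rcases lt_trichotomy j a with hja | rfl | haj
    · refine ⟨1, ?_⟩
      have hlt : ∀ x ∈ insert a S, j < x := by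
        simp only [Finset.mem_insert, forall_eq_or_imp]
        exact ⟨hja, fun x hx => hja.trans (ha x hx)⟩
      rw [← basisElt_insert hlt, one_smul]
      congr 1
      ext x
      have := hlt x
      simp only [Finset.mem_insert, Finset.mem_symmDiff, Finset.mem_singleton] at *
      grind
    · obtain ⟨c, hc⟩ := f_mul_self j
      refine ⟨c, ?_⟩
      rw [basisElt_insert ha, ← mul_assoc, hc, smul_mul_assoc, one_mul]
      congr 2
      ext x
      have := ha x
      simp only [Finset.mem_insert, Finset.mem_symmDiff, Finset.mem_singleton] at *
      grind
    · obtain ⟨c, hc⟩ := ih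
      refine ⟨-c, ?_⟩
      rw [basisElt_insert ha, ← mul_assoc, f_mul_f haj.ne', neg_mul, mul_assoc, hc,
        mul_smul_comm, ← basisElt_insert, neg_smul]
      · congr 3
        ext x
        simp only [Finset.mem_insert, Finset.mem_symmDiff, Finset.mem_singleton] at *
        grind
      · intro x hx
        have := ha x
        simp only [Finset.mem_symmDiff, Finset.mem_singleton] at hx
        grind

theorem even_card_symmDiff_singleton {α : Type*} [DecidableEq α] (S : Finset α) (j : α) :
    Even (symmDiff S {j}).card ↔ ¬ Even S.card := by
  by_cases hj : j ∈ S
  · have h : symmDiff S {j} = S.erase j := by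
      ext x
      simp only [Finset.mem_symmDiff, Finset.mem_singleton, Finset.mem_erase]
      grind
    rw [h, ← Finset.card_erase_add_one hj, Nat.even_add_one, not_not]
  · have h : symmDiff S {j} = insert j S := by
      ext x
      simp only [Finset.mem_symmDiff, Finset.mem_singleton, Finset.mem_insert]
      grind
    rw [h, Finset.card_insert_of_notMem hj, Nat.even_add_one]

theorem f_mul_f_mul_mem_Z0 (j k : Fin (d + 1)) {z : X d} (hz : z ∈ Z0 d) :
    f d j * (f d k * z) ∈ Z0 d := by
  induction hz using Submodule.span_induction with
  | mem x hx =>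
    obtain ⟨S, hS, rfl⟩ := hx
    obtain ⟨c, hc⟩ := f_mul_basisElt S k
    obtain ⟨c', hc'⟩ := f_mul_basisElt (symmDiff S {k}) j
    rw [hc, mul_smul_comm, hc']
    refine Submodule.smul_mem _ _ (Submodule.smul_mem _ _ (Submodule.subset_span ⟨_, ?_, rfl⟩))
    simpa [even_card_symmDiff_singleton] using hS
  | zero => simp
  | add x y _ _ hx hy => simpa only [mul_add] using Submodule.add_mem _ hx hy
  | smul c x _ hx => simpa only [mul_smul_comm] using Submodule.smul_mem _ c hx

/-- Two factors toggle the parity twice. This suffices to place rotors and translators in `Z0 d`,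
without showing that `Z0 d` is closed under products. -/
theorem mul_mul_mem_Z0 {A B : X d} (hA : A ∈ Submodule.span ℝ (Set.range (f d)))
    (hB : B ∈ Submodule.span ℝ (Set.range (f d))) {z : X d} (hz : z ∈ Z0 d) :
    A * (B * z) ∈ Z0 d := by
  induction hA using Submodule.span_induction with
  | mem x hx =>
    obtain ⟨j, rfl⟩ := hx
    induction hB using Submodule.span_induction with
    | mem x hx =>
      obtain ⟨k, rfl⟩ := hx
      exact f_mul_f_mul_mem_Z0 j k hz
    | zero => simp
    | add x y _ _ hx hy => simpa only [mul_add, add_mul] using Submodule.add_mem _ hx hy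
    | smul c x _ hx =>
      simpa only [mul_smul_comm, smul_mul_assoc] using Submodule.smul_mem _ c hx
  | zero => simp
  | add x y _ _ hx hy => simpa only [add_mul] using Submodule.add_mem _ hx hy
  | smul c x _ hx => simpa only [smul_mul_assoc] using Submodule.smul_mem _ c hx

theorem one_mem_Z0 : (1 : X d) ∈ Z0 d :=
  Submodule.subset_span ⟨∅, by simp, basisElt_empty.symm⟩

theorem i_mem_span_f (v : EuclideanSpace ℝ (Fin d)) :
    i d v ∈ Submodule.span ℝ (Set.range (f d)) :=
  Submodule.sum_mem _ fun j _ => Submodule.smul_mem _ _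
    (Submodule.subset_span ⟨j.castSucc, f_castSucc j⟩)

/-! ### A matrix representation -/

/-- Doubling: the blocks `diag(A, -A)` keep the relations of the `A j` and anticommute with the new
matrix `(0, 1; -1, 0)`, whose square is `-1`. -/
theorem exists_anticommuting_matrices (n : ℕ) :
    ∃ (ι : Type) (_ : Fintype ι) (_ : DecidableEq ι) (_ : Nonempty ι) (A : Fin n → Matrix ι ι ℝ),
      (∀ j k, j ≠ k → A j * A k + A k * A j = 0) ∧ ∀ j, A j * A j + 1 = 0 := by
  induction n with
  | zero => exact ⟨Unit, inferInstance, inferInstance, inferInstance, Fin.elim0,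
      fun j => j.elim0, fun j => j.elim0⟩
  | succ n ih =>
    obtain ⟨ι, _, _, _, A, hA, hA'⟩ := ih
    have key (j : Fin n) : Matrix.fromBlocks (A j) 0 0 (-A j) *
        Matrix.fromBlocks 0 (1 : Matrix ι ι ℝ) (-1) 0 +
        Matrix.fromBlocks 0 (1 : Matrix ι ι ℝ) (-1) 0 *
        Matrix.fromBlocks (A j) 0 0 (-A j) = 0 := by
      simp [Matrix.fromBlocks_multiply, Matrix.fromBlocks_add]
    refine ⟨ι ⊕ ι, inferInstance, inferInstance, inferInstance,
      Fin.lastCases (Matrix.fromBlocks 0 1 (-1) 0)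
        (fun j => Matrix.fromBlocks (A j) 0 0 (-A j)), fun j k hjk => ?_, fun j => ?_⟩
    · induction j using Fin.lastCases with
      | last =>
        induction k using Fin.lastCases with
        | last => exact absurd rfl hjk
        | cast k => simpa [add_comm] using key k
      | cast j =>
        induction k using Fin.lastCases with
        | last => simpa using key j
        | cast k => simp [Matrix.fromBlocks_multiply, Matrix.fromBlocks_add,
            hA j k (by simpa using hjk)]
    · rw [← Matrix.fromBlocks_one]
      induction j using Fin.lastCases with
      | last => simp [-Matrix.fromBlocks_one, Matrix.fromBlocks_multiply, Matrix.fromBlocks_add]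
      | cast j =>
        simp [-Matrix.fromBlocks_one, Matrix.fromBlocks_multiply, Matrix.fromBlocks_add, hA' j]

/-- There is a matrix representation `ρ` of `X_d` killing `e_{d+2}` whose kernel contains the
annihilator of `e_{d+2}`. -/
theorem exists_representation (d : ℕ) :
    ∃ (ι : Type) (_ : Fintype ι) (_ : DecidableEq ι) (_ : Nonempty ι)
      (ρ : X d →ₐ[ℝ] Matrix ι ι ℝ), ρ (e d (Fin.last (d + 1))) = 0 ∧
        ∀ x, e d (Fin.last (d + 1)) * x = 0 → ρ x = 0 := by
  obtain ⟨ι, _, _, _, A, hA, hA'⟩ := exists_anticommuting_matrices (d + 1)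
  -- Send `e_{d+2}` to the dual unit `ε`. The `ε`-part of `ε * D x` is the first component of `D x`,
  -- which is why `ρ` is taken to be that component.
  let D : X d →ₐ[ℝ] DualNumber (Matrix ι ι ℝ) :=
    lift d (Fin.lastCases (TrivSqZeroExt.inr 1) (fun j => TrivSqZeroExt.inl (A j))) (by
      intro x y h
      cases h with
      | anticomm j k hjk => simp [← TrivSqZeroExt.inl_mul, ← TrivSqZeroExt.inl_add, hA j k hjk]
      | sq j =>
        simp [← TrivSqZeroExt.inl_mul, ← TrivSqZeroExt.inl_add, ← TrivSqZeroExt.inl_one, hA' j]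
      | sq_last => simp
      | comm_last j => ext <;> simp)
  have hD : D (e d (Fin.last (d + 1))) = TrivSqZeroExt.inr 1 := by simp [D, lift_e]
  refine ⟨ι, inferInstance, inferInstance, inferInstance,
    (TrivSqZeroExt.fstHom ℝ (Matrix ι ι ℝ) (Matrix ι ι ℝ)).comp D, by simp [hD], fun x hx => ?_⟩
  simpa [hD] using congrArg (fun x => (D x).snd) hx

/-! ### The trace functional vanishes on `H0` -/

/-- The first factor anticommutes with the product of the remaining factors, which are odd in
number, while the trace is cyclic; so the trace equals its own negative. -/
theorem basisElt_trace {ι : Type} [Fintype ι] [DecidableEq ι] (ρ : X d →ₐ[ℝ] Matrix ι ι ℝ)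
    {S : Finset (Fin (d + 1))} (hS : Even S.card) (hne : S.Nonempty) :
    (ρ (basisElt d S)).trace = 0 := by
  have hmove (j : Fin (d + 1)) (S : Finset (Fin (d + 1))) (hj : ∀ x ∈ S, j < x) :
      f d j * basisElt d S = (-1 : ℝ) ^ S.card • (basisElt d S * f d j) := by
    induction S using Finset.induction_on_min with
    | empty => simp [basisElt_empty]
    | insert a S ha ih =>
      rw [basisElt_insert ha, ← mul_assoc, f_mul_f (hj a (Finset.mem_insert_self a S)).ne, neg_mul,
        mul_assoc, ih fun x hx => hj x (Finset.mem_insert_of_mem hx),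
        Finset.card_insert_of_notMem fun h => lt_irrefl _ (ha a h), pow_succ, mul_smul_comm,
        mul_assoc, mul_neg_one, neg_smul]
  induction S using Finset.induction_on_min with
  | empty => exact absurd hne Finset.not_nonempty_empty
  | insert a S ha _ =>
    rw [Finset.card_insert_of_notMem fun h => lt_irrefl _ (ha a h), Nat.even_add_one,
      Nat.not_even_iff_odd] at hS
    have h := congrArg (fun x => (ρ x).trace) (hmove a S ha)
    simp only [hS.neg_one_pow, neg_smul, one_smul, map_neg, map_mul, Matrix.trace_neg] at h
    rw [Matrix.trace_mul_comm (ρ (basisElt d S))] at h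
    rw [basisElt_insert ha, map_mul]
    linarith

theorem trace_eq_zero_of_mem_H0 {ι : Type} [Fintype ι] [DecidableEq ι]
    (ρ : X d →ₐ[ℝ] Matrix ι ι ℝ) {x : X d} (hx : x ∈ H0 d) : (ρ x).trace = 0 := by
  induction hx using Submodule.span_induction with
  | mem x hx =>
    obtain ⟨S, hS, hne, rfl⟩ := hx
    exact basisElt_trace ρ hS hne
  | zero => simp
  | add x y _ _ hx hy => simp [hx, hy]
  | smul c x _ hx => simp [hx]

theorem trace_i_mul_i {ι : Type} [Fintype ι] [DecidableEq ι] (ρ : X d →ₐ[ℝ] Matrix ι ι ℝ)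
    (v w : EuclideanSpace ℝ (Fin d)) :
    (ρ (i d v * i d w)).trace = -inner ℝ v w * Fintype.card ι := by
  have h := congrArg (fun x => (ρ x).trace) (i_mul_i_add_swap v w)
  simp only [map_add, map_mul, Matrix.trace_add, map_smul, map_one, Matrix.trace_smul,
    Matrix.trace_one, smul_eq_mul] at h
  rw [Matrix.trace_mul_comm (ρ (i d w))] at h
  rw [map_mul]
  linarith

/-! ### The action preserves distances -/

theorem pt_sub_pt (a b : EuclideanSpace ℝ (Fin d)) :
    pt d a - pt d b = e d (Fin.last (d + 1)) * i d (a - b) := by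
  rw [pt, pt, i_sub, mul_sub]
  abel

theorem e_last_commute (x : X d) : Commute (e d (Fin.last (d + 1))) x := by
  obtain ⟨x, rfl⟩ := RingQuot.mkAlgHom_surjective ℝ (Rel d) x
  change Commute _ (mk d x)
  induction x using FreeAlgebra.induction with
  | grade0 r => rw [AlgHom.commutes]; exact (Algebra.commutes r _).symm
  | grade1 j =>
    change Commute _ (e d j)
    induction j using Fin.lastCases with
    | last => exact Commute.refl _
    | cast j => exact e_last_commute_e j
  | mul a b ha hb => rw [map_mul]; exact ha.mul_right hb
  | add a b ha hb => rw [map_add]; exact ha.add_right hb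

theorem dist_eq_of_act {x y : X d} {a b p q : EuclideanSpace ℝ (Fin d)} (hx : x * y = 1)
    (ha : x * pt d a * y = pt d p) (hb : x * pt d b * y = pt d q) : dist a b = dist p q := by
  obtain ⟨ι, _, _, _, ρ, -, hρ⟩ := exists_representation d
  have h : e d (Fin.last (d + 1)) * (x * i d (a - b) * y - i d (p - q)) = 0 := by
    rw [mul_sub, ← pt_sub_pt p q, ← ha, ← hb, ← sub_mul, ← mul_sub, pt_sub_pt, ← mul_assoc,
      ← mul_assoc, (e_last_commute x).eq, mul_assoc x, sub_self]
  have h1 := hρ _ h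
  rw [map_sub, sub_eq_zero, map_mul, map_mul] at h1
  -- For square matrices a one-sided inverse is two-sided.
  have hyx : ρ y * ρ x = 1 := by
    rw [mul_eq_one_comm, ← map_mul, hx, map_one]
  have hxy : ρ x * ρ y = 1 := mul_eq_one_comm.mp hyx
  have h2 : (-‖a - b‖ ^ 2) • (1 : Matrix ι ι ℝ) = (-‖p - q‖ ^ 2) • 1 := by
    have hs (v : EuclideanSpace ℝ (Fin d)) :
        ρ (i d v) * ρ (i d v) = (-‖v‖ ^ 2) • (1 : Matrix ι ι ℝ) := by
      rw [← map_mul, i_mul_self, map_smul, map_one]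
    rw [← hs (p - q), ← h1]
    calc _ = ρ x * (ρ (i d (a - b)) * ρ (i d (a - b))) * ρ y := by
          rw [hs, mul_smul_comm, smul_mul_assoc, mul_one, hxy]
      _ = ρ x * ρ (i d (a - b)) * 1 * ρ (i d (a - b)) * ρ y := by simp only [mul_assoc, one_mul]
      _ = _ := by rw [← hyx]; simp only [mul_assoc]
  have h3 := smul_left_injective ℝ (one_ne_zero (α := Matrix ι ι ℝ)) h2
  rw [dist_eq_norm, dist_eq_norm]
  exact (sq_eq_sq₀ (norm_nonneg _) (norm_nonneg _)).mp (neg_injective h3)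

theorem Q'_subset_Q (P : Finset (EuclideanSpace ℝ (Fin d))) : Q' d P ⊆ Q d P := by
  rintro ⟨a, p, b, q⟩ ⟨ha, hp, hb, hq, hab, hT⟩
  obtain ⟨x, ⟨⟨hx, h1⟩, -, h2⟩, -⟩ := Set.not_subset.mp hT
  have h := dist_eq_of_act hx.2.1 h1 h2
  exact ⟨ha, hp, hb, hq, h, h ▸ dist_pos.mpr hab⟩

/-! ### Translations and rotations -/

/-- The element of `Spun(d)` acting as the translation by `c`. -/
noncomputable def translator (d : ℕ) (c : EuclideanSpace ℝ (Fin d)) : X d :=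
  1 + (1 / 2 : ℝ) • (f d (Fin.last d) * i d c)

theorem conj_f_last : conj d (f d (Fin.last d)) = -f d (Fin.last d) := by
  rw [f_last, conj_mul, conj_e, conj_e_last, mul_neg, (e_last_commute_e _).eq]

theorem f_last_mul_i (c : EuclideanSpace ℝ (Fin d)) :
    f d (Fin.last d) * i d c = -(i d c * f d (Fin.last d)) := by
  rw [f_last, mul_assoc, (e_last_commute_i c).eq, ← mul_assoc, e_mul_i, neg_mul, mul_assoc]

theorem conj_translator (c : EuclideanSpace ℝ (Fin d)) :
    conj d (translator d c) = 1 - (1 / 2 : ℝ) • (f d (Fin.last d) * i d c) := by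
  rw [translator, conj_add, conj_one, conj_smul, conj_mul, conj_f_last, conj_i, neg_mul_neg,
    f_last_mul_i, smul_neg, sub_neg_eq_add]

theorem f_last_mul_e_last : f d (Fin.last d) * e d (Fin.last (d + 1)) = 0 := by
  rw [f_last, mul_assoc, e_last_mul_self, mul_zero]

theorem f_last_mul_i_mul_self (c c' : EuclideanSpace ℝ (Fin d)) :
    f d (Fin.last d) * i d c * (f d (Fin.last d) * i d c') = 0 := by
  rw [f_last_mul_i, neg_mul, mul_assoc, ← mul_assoc (f d _) (f d _)]
  have : f d (Fin.last d) * f d (Fin.last d) = 0 := by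
    nth_rewrite 2 [f_last]
    rw [← (e_last_commute_e _).eq, ← mul_assoc, f_last_mul_e_last, zero_mul]
  rw [this, zero_mul, mul_zero, neg_zero]

theorem N_translator (c : EuclideanSpace ℝ (Fin d)) : N d (translator d c) = 1 := by
  have h := f_last_mul_i_mul_self c c
  rw [N, conj_translator, translator, add_mul, mul_sub, mul_sub, smul_mul_smul_comm, h]
  simp

/-- Since `e_{d+2}² = 0`, the correction terms act only on `e_{d+1}`; left and right factors each
contribute `c / 2`. -/
theorem translator_act (c v : EuclideanSpace ℝ (Fin d)) :
    translator d c * pt d v * conj d (translator d c) = pt d (v + c) := by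
  have h1 : f d (Fin.last d) * i d c * e d (Fin.last (d + 1)) = 0 := by
    rw [mul_assoc, ← (e_last_commute_i c).eq, ← mul_assoc, f_last_mul_e_last, zero_mul]
  have h2 : e d (Fin.last (d + 1)) * f d (Fin.last d) = 0 := by
    rw [(e_last_commute _).eq, f_last_mul_e_last]
  have h3 : f d (Fin.last d) * i d c * e d (Fin.last d).castSucc =
      e d (Fin.last (d + 1)) * i d c := by
    rw [f_last, mul_assoc, ← neg_neg (i d c * e d (Fin.last d).castSucc), ← e_mul_i,
      ← (e_last_commute_e _).eq, mul_neg, mul_assoc, ← mul_assoc (e d _) (e d _) (i d c),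
      e_mul_self, neg_one_mul, mul_neg, neg_neg]
  have h4 : e d (Fin.last d).castSucc * (f d (Fin.last d) * i d c) =
      -(e d (Fin.last (d + 1)) * i d c) := by
    rw [f_last, ← mul_assoc, ← mul_assoc, e_mul_self, neg_one_mul, neg_mul]
  have hl : translator d c * pt d v = pt d v + (1 / 2 : ℝ) • (e d (Fin.last (d + 1)) * i d c) := by
    rw [translator, add_mul, one_mul, smul_mul_assoc]
    congr 2
    rw [pt, mul_add, ← mul_assoc, h1, h3, zero_mul, zero_add]
  have h5 (w : EuclideanSpace ℝ (Fin d)) :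
      e d (Fin.last (d + 1)) * i d w * (f d (Fin.last d) * i d c) = 0 := by
    rw [(e_last_commute_i w).eq, mul_assoc, ← mul_assoc (e d _), h2, zero_mul, mul_zero]
  rw [hl, conj_translator, mul_sub, mul_one, mul_smul_comm, add_mul, smul_mul_assoc, h5, smul_zero,
    add_zero, pt, add_mul, h5, zero_add, h4, pt, i_add, mul_add]
  module

/-- The product of two vectors, which acts on vectors as a scaled rotation. -/
noncomputable def rotor (d : ℕ) (k : ℝ) (m u : EuclideanSpace ℝ (Fin d)) : X d :=
  k • (i d m * i d u)

theorem conj_rotor (k : ℝ) (m u : EuclideanSpace ℝ (Fin d)) :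
    conj d (rotor d k m u) = k • (i d u * i d m) := by
  rw [rotor, conj_smul, conj_mul, conj_i, conj_i, neg_mul_neg]

theorem rotor_mul_i_mul_conj (k : ℝ) (m u v : EuclideanSpace ℝ (Fin d)) :
    rotor d k m u * i d v * conj d (rotor d k m u) =
      k ^ 2 • (i d m * (i d u * i d v * i d u) * i d m) := by
  rw [conj_rotor, rotor]
  simp only [smul_mul_assoc, mul_smul_comm, smul_smul, mul_assoc, sq]

theorem N_rotor (k : ℝ) (m u : EuclideanSpace ℝ (Fin d)) :
    N d (rotor d k m u) = (k * ‖m‖ * ‖u‖) ^ 2 • 1 := by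
  rw [N, conj_rotor, rotor, smul_mul_smul_comm, mul_assoc, ← mul_assoc (i d u), i_mul_self,
    smul_mul_assoc, mul_smul_comm, one_mul, i_mul_self, smul_smul, smul_smul]
  congr 1
  ring

/-- The rotor is even in `e_1, …, e_d`, so it commutes with `e_{d+1}`, and `e_{d+2}` is central;
only the action on vectors remains. -/
theorem rotor_act {k : ℝ} {m u v w : EuclideanSpace ℝ (Fin d)} (hk : (k * ‖m‖ * ‖u‖) ^ 2 = 1)
    (hv : rotor d k m u * i d v * conj d (rotor d k m u) = i d w) :
    rotor d k m u * pt d v * conj d (rotor d k m u) = pt d w := by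
  have hN := N_rotor k m u
  rw [hk, one_smul, N] at hN
  have hF : Commute (e d (Fin.last d).castSucc) (rotor d k m u) := by
    refine Commute.smul_right ?_ k
    rw [Commute, SemiconjBy, ← mul_assoc, e_mul_i, neg_mul, mul_assoc, e_mul_i, mul_neg, neg_neg,
      mul_assoc]
  rw [pt, mul_add, add_mul, ← mul_assoc, ← (e_last_commute _).eq, mul_assoc (e d _), mul_assoc,
    hv, ← hF.eq, mul_assoc, hN, mul_one, pt]

theorem rotor_act_exists (k : ℝ) (m u v : EuclideanSpace ℝ (Fin d)) :
    ∃ w, rotor d k m u * i d v * conj d (rotor d k m u) = i d w := by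
  rw [rotor_mul_i_mul_conj, i_mul_i_mul_i, i_mul_i_mul_i, ← i_smul]
  exact ⟨_, rfl⟩

/-- If `‖u‖ = ‖w‖`, the rotor of `u + w` and `u` takes `u` to `w`. -/
theorem rotor_add_act {k : ℝ} {u w : EuclideanSpace ℝ (Fin d)} (h : ‖u‖ = ‖w‖)
    (hk : (k * ‖u + w‖ * ‖u‖) ^ 2 = 1) :
    rotor d k (u + w) u * i d u * conj d (rotor d k (u + w) u) = i d w := by
  -- Equal norms give `2⟨u + w, u⟩ = ‖u + w‖²`, so sandwiching `u` by `u + w` yields `-‖u + w‖² w`.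
  have h1 : ‖u + w‖ ^ 2 = 2 * (‖u‖ ^ 2 + inner ℝ u w) := by
    rw [norm_add_sq_real, ← h]
    ring
  have h2 : inner ℝ (u + w) u = ‖u‖ ^ 2 + inner ℝ u w := by
    rw [inner_add_left, real_inner_self_eq_norm_sq, real_inner_comm]
  rw [rotor_mul_i_mul_conj, i_mul_self, smul_mul_assoc, one_mul, mul_smul_comm, smul_mul_assoc,
    i_mul_i_mul_i, h2, ← h1, ← smul_sub, ← i_smul, ← i_smul]
  congr 1
  have h3 : k ^ 2 • (-‖u‖ ^ 2) • ‖u + w‖ ^ 2 • (u - (u + w)) = (k * ‖u + w‖ * ‖u‖) ^ 2 • w := by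
    module
  rw [h3, hk, one_smul]

/-! ### Counting -/

theorem mem_Q'_of_ne {P : Finset (EuclideanSpace ℝ (Fin d))} {a p b q : EuclideanSpace ℝ (Fin d)}
    (h : (a, p, b, q) ∈ Q d P) (hne : (a - b) + (p - q) ≠ 0) : (a, p, b, q) ∈ Q' d P := by
  obtain ⟨ha, hp, hb, hq, hd, hpos⟩ := h
  refine ⟨ha, hp, hb, hq, dist_pos.mp (hd ▸ hpos), fun hT => ?_⟩
  rw [dist_eq_norm, dist_eq_norm] at hd
  rw [dist_eq_norm, ← hd] at hpos
  set u := a - b with hu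
  set w := p - q with hw
  have hm : 0 < ‖u + w‖ := norm_pos_iff.mpr hne
  set k := (‖u + w‖ * ‖u‖)⁻¹ with hkdef
  have hk : (k * ‖u + w‖ * ‖u‖) ^ 2 = 1 := by
    rw [mul_assoc, hkdef, inv_mul_cancel₀ (by positivity), one_pow]
  set r := rotor d k (u + w) u with hr
  have hru : r * i d u * conj d r = i d w := rotor_add_act hd hk
  -- The rotation sends `a` to `a'` and, by linearity, `b` to `a' - w`; translating by `p - a'` then
  -- gives `p` and `p - w = q`.
  obtain ⟨a', ha'⟩ := rotor_act_exists k (u + w) u a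
  set x := translator d (p - a') * r with hx
  have hact {v v' : EuclideanSpace ℝ (Fin d)} (hv : r * i d v * conj d r = i d v') :
      x * pt d v * conj d x = pt d (v' + (p - a')) := by
    rw [← translator_act, ← rotor_act hk hv, hx, conj_mul]
    simp only [mul_assoc, ← hr]
  have hb' : r * i d b * conj d r = i d (a' - w) := by
    rw [i_sub, ← hru, ← ha', hu, i_sub, ← hr]
    simp only [mul_sub, sub_mul]
    abel
  have hxZ : x ∈ Z0 d := by
    have hrZ : r ∈ Z0 d := by
      have := mul_mul_mem_Z0 (i_mem_span_f (u + w)) (i_mem_span_f u) one_mem_Z0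
      rw [mul_one] at this
      exact Submodule.smul_mem _ _ this
    rw [hx, translator, add_mul, one_mul, smul_mul_assoc, mul_assoc]
    exact Submodule.add_mem _ hrZ (Submodule.smul_mem _ _ (mul_mul_mem_Z0
      (Submodule.subset_span ⟨_, rfl⟩) (i_mem_span_f _) hrZ))
  have hxN : N d x = 1 := by
    have h1 := N_rotor k (u + w) u
    rw [hk, one_smul, N, ← hr] at h1
    rw [N, hx, conj_mul, mul_assoc, ← mul_assoc r, h1, one_mul]
    exact N_translator _
  have hxS : x ∈ Spun d := by
    refine ⟨hxZ, hxN, fun v => ?_⟩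
    obtain ⟨v', hv'⟩ := rotor_act_exists k (u + w) u v
    exact ⟨_, hact hv'⟩
  have hxH : x ∈ H0 d := by
    refine hT ⟨⟨hxS, ?_⟩, hxS, ?_⟩
    · rw [hact ha', add_sub_cancel]
    · rw [hact hb']
      congr 1
      rw [hw]
      abel
  -- As `ρ` kills `e_{d+2}`, the translator maps to `1`, and the trace of `ρ x` is `-k⟨u + w, u⟩`
  -- times the size of the matrices.
  obtain ⟨ι, _, _, _, ρ, hρ, -⟩ := exists_representation d
  have htr := trace_eq_zero_of_mem_H0 ρ hxH
  rw [hx, map_mul, translator, map_add, map_one, map_smul, map_mul, f_last, map_mul, hρ, mul_zero,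
    zero_mul, smul_zero, add_zero, one_mul, hr, rotor, map_smul, Matrix.trace_smul,
    trace_i_mul_i, smul_eq_mul] at htr
  have hin : 0 < inner ℝ (u + w) u := by
    have h1 : ‖u + w‖ ^ 2 = 2 * inner ℝ (u + w) u := by
      rw [norm_add_sq_real, inner_add_left, real_inner_self_eq_norm_sq, ← hd, real_inner_comm]
      ring
    nlinarith
  have hcard : (0 : ℝ) < Fintype.card ι := by exact_mod_cast Fintype.card_pos
  have hk0 : 0 < k := by positivity
  have : 0 < k * (inner ℝ (u + w) u * Fintype.card ι) := by positivity
  linarith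

/-- The involution of quadruples exchanging `p` and `q`. -/
def swapTargets (x : Quad d) : Quad d := (x.1, x.2.2.2, x.2.2.1, x.2.1)

theorem Q_subset_union (P : Finset (EuclideanSpace ℝ (Fin d))) :
    Q d P ⊆ Q' d P ∪ swapTargets '' Q' d P := by
  rintro ⟨a, p, b, q⟩ h
  by_cases hne : (a - b) + (p - q) = 0
  · right
    refine ⟨(a, q, b, p), mem_Q'_of_ne ?_ fun h0 => ?_, rfl⟩
    · obtain ⟨ha, hp, hb, hq, hd, hpos⟩ := h
      rw [dist_comm p q] at hd hpos
      exact ⟨ha, hq, hb, hp, hd, hpos⟩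
    · obtain ⟨-, -, -, -, -, hpos⟩ := h
      -- If both `u + w` and `u - w` vanished, their difference `2w` would too.
      have h2 : (2 : ℝ) • (p - q) = 0 := by
        have := congrArg₂ (· - ·) hne h0
        simp only [sub_zero] at this
        rw [← this]
        module
      rw [smul_eq_zero_iff_right two_ne_zero, sub_eq_zero] at h2
      exact (dist_pos.mp hpos) h2
  · exact Or.inl (mem_Q'_of_ne h hne)

theorem Q_finite (P : Finset (EuclideanSpace ℝ (Fin d))) : (Q d P).Finite := by
  refine (P ×ˢ P ×ˢ P ×ˢ P).finite_toSet.subset ?_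
  rintro ⟨a, p, b, q⟩ ⟨ha, hp, hb, hq, -⟩
  simp [ha, hp, hb, hq]

end SpunGroup

theorem corollary5p14 (d : ℕ) (P : Finset (EuclideanSpace ℝ (Fin d))) :
    SpunGroup.Q' d P ⊆ SpunGroup.Q d P ∧
      ((SpunGroup.Q d P).ncard : ℝ) / 2 ≤ ((SpunGroup.Q' d P).ncard : ℝ) := by
  refine ⟨SpunGroup.Q'_subset_Q P, ?_⟩
  have hfin : (SpunGroup.Q' d P).Finite := (SpunGroup.Q_finite P).subset (SpunGroup.Q'_subset_Q P)
  have h : (SpunGroup.Q d P).ncard ≤ (SpunGroup.Q' d P).ncard + (SpunGroup.Q' d P).ncard :=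
    (Set.ncard_le_ncard (SpunGroup.Q_subset_union P) (hfin.union (hfin.image _))).trans
      ((Set.ncard_union_le _ _).trans (Nat.add_le_add_left (Set.ncard_image_le hfin) _))
  have h' : ((SpunGroup.Q d P).ncard : ℝ) ≤
      (SpunGroup.Q' d P).ncard + (SpunGroup.Q' d P).ncard := by exact_mod_cast h
  linarith
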